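/- Let $L$ be a complete lattice that is modular and meet-continuous (that is, $a\wedge\bigvee D=\bigvee_{d\in D}(a\wedge d)$ for every $a\in L$ and every upward directed $D\subseteq L$). Definitions, for an arbitrary modular lattice $M$. Write $u\prec v$ when $v$ covers $u$. A pair $\langle u,v\rangle$ transposes up to $\langle z,w\rangle$, written $\langle u,v\rangle\nearrow\langle z,w\rangle$, if $v\wedge z=u$ and $v\vee z=w$; projective equivalence $\sim$ is the equivalence relation on pairs generated by $\nearrow$. For a covering $u\prec v$ and a chain $C\subseteq M$, let $\mu_C[u\prec v]$ be the cardinality of the set of coverings $a\prec b$ of $M$ with $a,b\in C$ and $\langle a,b\rangle\sim\langle u,v\rangle$. The multiplicity upper bound $\upsilon[u\prec v]$ is the least cardinal $\nu$ such that $\mu_C[u\prec v]<\nu$ for every chain $C$ in $M$. We say that $u\prec v$ has multiplicity $\mu$ if $\mu_C[u\prec v]=\mu$ for every maximal chain $C$ in $M$. If $M$ is complete, then $u\prec v$ is regular if for every nonempty chain $I$ and every family of coverings $u_i\prec v_i$ $(i\in I)$ of $M$ that are projectively equivalent to $u\prec v$ and satisfy $\langle u_i,v_i\rangle\nearrow\langle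 u_j,v_j\rangle$ whenever $i<j$, we have both $\bigvee_i u_i\prec\bigvee_i v_i$ and $\bigwedge_i u_i\prec\bigwedge_i v_i$. Let $\operatorname{Fil}L$ be the complete modular lattice of nonempty filters of $L$, ordered by reverse inclusion, and let $\operatorname{Fg}\{x\}=\{z\in L: z\ge x\}$. Theorem. Let $x\prec y$ be a covering in $L$ such that $\upsilon[x\prec y]$ is finite. Then $\operatorname{Fg}\{x\}\prec\operatorname{Fg}\{y\}$ is a regular covering in $\operatorname{Fil}L$. Moreover it has a multiplicity: there is a cardinal $\mu$ such that $\mu_C[\operatorname{Fg}\{x\}\prec\operatorname{Fg}\{y\}]=\mu$ for every maximal chain $C$ in $\operatorname{Fil}L$. This multiplicity is the one corresponding to the bound $\upsilon[x\prec y]$, namely $\upsilon[x\prec y]=\operatorname{Succ}\mu=\mu+1$. (Since $\upsilon$ is a strict bound, this says that $\mu$ is the largest value of $\mu_C[x\prec y]$ over all chains $C$ in $L$.) -/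

import Mathlib

universe u

namespace LatticeCovering

/-- A complete lattice is meet-continuous if binary meets distribute over joins of
upward directed sets. -/
def IsMeetContinuous (L : Type u) [CompleteLattice L] : Prop :=
  ∀ (a : L) (D : Set L), DirectedOn (· ≤ ·) D → a ⊓ sSup D = ⨆ d ∈ D, a ⊓ d

/-- `⟨x, y⟩ ↗ ⟨z, w⟩`: the pair `p = ⟨x, y⟩` transposes up to `q = ⟨z, w⟩`, i.e. `y ⊓ z = x` and
`y ⊔ z = w`. (These equations force `x ≤ y` and `z ≤ w`.) -/
def TransposesUp {L : Type u} [Lattice L] (p q : L × L) : Prop :=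
  p.2 ⊓ q.1 = p.1 ∧ p.2 ⊔ q.1 = q.2

/-- Projective equivalence of pairs: the equivalence relation generated by `TransposesUp`. -/
def ProjEquiv {L : Type u} [Lattice L] : L × L → L × L → Prop :=
  Relation.EqvGen TransposesUp

/-- The `C`-multiplicity `μ_C[x ≺ y]`: the number of coverings `u ≺ v` with `u, v ∈ C` that are
projectively equivalent to `x ≺ y`. -/
def chainMultiplicity {L : Type u} [Lattice L] (C : Set L) (x y : L) : Cardinal.{u} :=
  Cardinal.mk {p : L × L // p.1 ∈ C ∧ p.2 ∈ C ∧ p.1 ⋖ p.2 ∧ ProjEquiv p (x, y)}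

/-- `x ≺ y` is weakly regular with multiplicity `n`: the `C`-multiplicity of `x ≺ y` is `n` for
every maximal chain `C`. (Maximal chains exist, so there is at most one such `n`.) -/
def HasMultiplicity {L : Type u} [Lattice L] (x y : L) (n : Cardinal.{u}) : Prop :=
  ∀ C : Set L, IsMaxChain (· ≤ ·) C → chainMultiplicity C x y = n

/-- The multiplicity upper bound `υ[x ≺ y]`: the least cardinal `ν` such that
`μ_C[x ≺ y] < ν` (strictly) for every chain `C`. -/
noncomputable def multiplicityUpperBound {L : Type u} [Lattice L] (x y : L) : Cardinal.{u} :=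
  sInf {ν : Cardinal.{u} | ∀ C : Set L, IsChain (· ≤ ·) C → chainMultiplicity C x y < ν}

/-- Such cardinals `ν` exist, so that the infimum above is attained. -/
theorem multiplicityUpperBound_spec {L : Type u} [Lattice L] (x y : L) (C : Set L)
    (hC : IsChain (· ≤ ·) C) : chainMultiplicity C x y < multiplicityUpperBound x y := by
  have hne : {ν : Cardinal.{u} |
      ∀ C : Set L, IsChain (· ≤ ·) C → chainMultiplicity C x y < ν}.Nonempty :=
    ⟨Order.succ (Cardinal.mk (L × L)), fun C _ =>
      Order.lt_succ_of_le (Cardinal.mk_subtype_le _)⟩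
  exact csInf_mem hne C hC

/-- `p` assigns, to the members of the chain `I`, coverings projectively equivalent to `x ≺ y` such
that `p i ↗ p j` whenever `i < j`. -/
structure IsCoveringChain {L : Type u} [Lattice L] (x y : L) {I : Type u} [LinearOrder I]
    (p : I → L × L) : Prop where
  covBy : ∀ i, (p i).1 ⋖ (p i).2
  equiv : ∀ i, ProjEquiv (p i) (x, y)
  transposesUp : ∀ i j, i < j → TransposesUp (p i) (p j)

/-- Upper regularity of a covering `x ≺ y` of a complete lattice. -/
def IsUpperRegular {L : Type u} [CompleteLattice L] (x y : L) : Prop :=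
  ∀ (I : Type u) [LinearOrder I] [Nonempty I] (p : I → L × L), IsCoveringChain x y p →
    (⨆ i, (p i).1) ⋖ (⨆ i, (p i).2)

/-- Lower regularity, the dual of upper regularity. (Dualizing reverses both `↗` and the roles of
the indices, so that the families considered are the same.) -/
def IsLowerRegular {L : Type u} [CompleteLattice L] (x y : L) : Prop :=
  ∀ (I : Type u) [LinearOrder I] [Nonempty I] (p : I → L × L), IsCoveringChain x y p →
    (⨅ i, (p i).1) ⋖ (⨅ i, (p i).2)

/-- A regular covering: a covering that is both upper regular and lower regular. -/
structure IsRegularCovering {L : Type u} [CompleteLattice L] (x y : L) : Prop where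
  covBy : x ⋖ y
  upper : IsUpperRegular x y
  lower : IsLowerRegular x y

/-- The lattice of (nonempty) filters of `L`, ordered by reverse inclusion: `F ≤ G` iff
`G ⊆ F`. -/
def Fil (L : Type u) [Lattice L] : Type u := (Order.PFilter L)ᵒᵈ

namespace Fil

variable {L : Type u} [Lattice L]

/-- The filter as a Mathlib filter of the order `L`. -/
def toPFilter (F : Fil L) : Order.PFilter L := OrderDual.ofDual F

/-- A Mathlib filter of the order `L` as an element of `Fil L`. -/
def ofPFilter (F : Order.PFilter L) : Fil L := OrderDual.toDual F

instance : PartialOrder (Fil L) := inferInstanceAs (PartialOrder (Order.PFilter L)ᵒᵈ)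

theorem le_iff {F G : Fil L} : F ≤ G ↔ (G.toPFilter : Set L) ⊆ F.toPFilter := Iff.rfl

/-- The intersection of a family of filters of a lattice with a top element. -/
def inter [OrderTop L] (S : Set (Fil L)) : Fil L :=
  ofPFilter (Order.IsPFilter.toPFilter (F := {x : L | ∀ F ∈ S, x ∈ F.toPFilter})
    (Order.IsPFilter.of_def ⟨⊤, fun _ _ => Order.PFilter.top_mem⟩
      (fun x hx y hy => ⟨x ⊓ y, fun F hF => Order.PFilter.inf_mem (hx F hF) (hy F hF),
        inf_le_left, inf_le_right⟩)
      (fun hxy hx F hF => Order.PFilter.mem_of_le hxy (hx F hF))))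

instance [OrderTop L] : SupSet (Fil L) := ⟨inter⟩

theorem mem_sSup [OrderTop L] {S : Set (Fil L)} {x : L} :
    x ∈ (sSup S).toPFilter ↔ ∀ F ∈ S, x ∈ F.toPFilter := Iff.rfl

/-- The filters of a lattice with a top element form a complete lattice, in which joins are
intersections. -/
instance [OrderTop L] : CompleteLattice (Fil L) :=
  completeLatticeOfSup (Fil L) fun S =>
    ⟨fun _ hF => le_iff.2 fun _ hx => mem_sSup.1 hx _ hF,
      fun _ hG => le_iff.2 fun _ hx => mem_sSup.2 fun _ hF => le_iff.1 (hG hF) hx⟩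

/-- The principal filter `Fg{x} = {z | x ≤ z}`. -/
def principal (x : L) : Fil L := ofPFilter (Order.PFilter.principal x)

theorem mem_principal {x z : L} : z ∈ (principal x).toPFilter ↔ x ≤ z := Iff.rfl

end Fil

end LatticeCovering

open LatticeCovering

/-! Let n be the largest number of coverings equivalent to x ≺ y in a chain of L. The proof first
shows that n also bounds chains in Fil L. A covering of filters p equivalent to the principal one
transposes up to a principal covering: each z in p.1 but not in p.2 gives a covering z ≺ w of L
equivalent to x ≺ y in L itself (`exists_isEquivCovering`). Finite families thus descend to L
(`exists_isCoveringFamily_card_eq`).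

The bound gives upper regularity through `not_le_iSup`. Far enough up a directed family of filters,
no equivalent coverings remain to be crossed. The elements of L reachable without crossing one are
closed under finite joins, and meet-continuity extends the avoidance of z ≺ w to their supremum.
Lower regularity holds because directed meets of filters are unions.

For the multiplicity, a covering p cuts a maximal chain of filters according to whether c ⊓ p.2 ≤
p.1. The same two continuity facts make the cut a jump equivalent to p
(`exists_covBy_of_isMaxChain`), and distinct coverings of one chain give distinct jumps. So every
maximal chain realizes n. -/

namespace LatticeCovering

/-! ### Coverings and intervals free of them in a modular lattice -/

section Modular

variable {M : Type u} [Lattice M] {x y : M} {p q : M × M}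

/-- The coverings projectively equivalent to `x ≺ y`. -/
def IsEquivCovering (x y : M) (p : M × M) : Prop :=
  p.1 ⋖ p.2 ∧ ProjEquiv p (x, y)

theorem inf_eq_of_covBy {a b c : M} (h : a ⋖ b) (hc : a ≤ c) (hbc : ¬ b ≤ c) : b ⊓ c = a := by
  rcases h.eq_or_eq (le_inf h.le hc) inf_le_left with h1 | h1
  · exact h1
  · exact absurd (inf_eq_left.1 h1) hbc

theorem TransposesUp.trans {p q r : M × M} (h₁ : TransposesUp p q) (h₂ : TransposesUp q r) :
    TransposesUp p r := by
  obtain ⟨a, b⟩ := h₁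
  obtain ⟨c, d⟩ := h₂
  have hpq : p.2 ≤ q.2 := b ▸ le_sup_left
  have hq : q.1 ≤ r.1 := c ▸ inf_le_right
  refine ⟨?_, ?_⟩
  · rw [← inf_eq_left.2 hpq, inf_assoc, c, a]
  · rw [← d, ← b, sup_assoc, sup_eq_right.2 hq]

variable [IsModularLattice M]

theorem TransposesUp.covBy_iff (h : TransposesUp p q) : p.1 ⋖ p.2 ↔ q.1 ⋖ q.2 := by
  obtain ⟨a, b⟩ := h
  constructor
  · intro h
    rw [← a] at h
    rw [← b]
    exact h.sup_of_inf_left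
  · intro h
    rw [← b] at h
    rw [← a]
    exact h.inf_of_sup_right

theorem TransposesUp.isEquivCovering_iff (h : TransposesUp p q) :
    IsEquivCovering x y p ↔ IsEquivCovering x y q :=
  and_congr h.covBy_iff
    ⟨fun k => (Relation.EqvGen.rel _ _ h).symm.trans _ _ _ k,
      fun k => (Relation.EqvGen.rel _ _ h).trans _ _ _ k⟩

/-- With `IsEquivCovering.inf` this forms a dichotomy: for every a, either joining or meeting with a
carries p to an equivalent covering. -/
theorem IsEquivCovering.sup (hp : IsEquivCovering x y p) {a : M} (h : ¬ p.2 ≤ p.1 ⊔ a) :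
    IsEquivCovering x y (p.1 ⊔ a, p.2 ⊔ a) := by
  refine (TransposesUp.isEquivCovering_iff ⟨?_, ?_⟩).1 hp
  · exact inf_eq_of_covBy hp.1 le_sup_left h
  · change p.2 ⊔ (p.1 ⊔ a) = p.2 ⊔ a
    rw [← sup_assoc, sup_eq_left.2 hp.1.le]

theorem IsEquivCovering.inf (hp : IsEquivCovering x y p) {a : M} (h : p.2 ≤ p.1 ⊔ a) :
    IsEquivCovering x y (p.1 ⊓ a, p.2 ⊓ a) := by
  refine (TransposesUp.isEquivCovering_iff ⟨?_, ?_⟩).2 hp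
  · change p.2 ⊓ a ⊓ p.1 = p.1 ⊓ a
    rw [inf_right_comm, inf_eq_right.2 hp.1.le]
  · change p.2 ⊓ a ⊔ p.1 = p.2
    rw [inf_sup_assoc_of_le a hp.1.le, sup_comm, inf_eq_left.2 h]

/-- There is no covering equivalent to `x ≺ y` between `a` and `b`. -/
def IsFree (x y a b : M) : Prop :=
  ∀ p, IsEquivCovering x y p → a ≤ p.1 → ¬ p.2 ≤ b

/-- A covering between a and c survives meeting or joining with b, and so moves into one of the two
halves. -/
theorem IsFree.trans {a b c : M} (hab : a ≤ b) (hbc : b ≤ c) (h₁ : IsFree x y a b)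
    (h₂ : IsFree x y b c) : IsFree x y a c := by
  intro p hp ha hc
  by_cases h : p.2 ≤ p.1 ⊔ b
  · exact h₁ _ (hp.inf h) (le_inf ha hab) inf_le_right
  · exact h₂ _ (hp.sup h) le_sup_right (sup_le hc hbc)

theorem IsFree.sup {a u v : M} (hau : a ≤ u) (hav : a ≤ v) (h₁ : IsFree x y a u)
    (h₂ : IsFree x y a v) : IsFree x y a (u ⊔ v) := by
  refine h₁.trans hau le_sup_left fun p hp hu hp2 => ?_
  refine h₂ _ (hp.inf (a := v) (hp2.trans (sup_le_sup_right hu v))) (le_inf (hau.trans hu) hav)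
    inf_le_right

/-! ### Finite families of coverings in a chain -/

/-- A finite set of coverings equivalent to `x ≺ y` that occur in a common chain. -/
structure IsCoveringFamily (x y : M) (s : Finset (M × M)) : Prop where
  covering : ∀ p ∈ s, IsEquivCovering x y p
  le_or_le : ∀ p ∈ s, ∀ q ∈ s, p ≠ q → p.2 ≤ q.1 ∨ q.2 ≤ p.1

omit [IsModularLattice M] in
theorem isCoveringFamily_empty : IsCoveringFamily x y (∅ : Finset (M × M)) :=
  ⟨by simp, by simp⟩

omit [IsModularLattice M] in
theorem IsCoveringFamily.subset {s t : Finset (M × M)} (hs : IsCoveringFamily x y s)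
    (h : t ⊆ s) : IsCoveringFamily x y t :=
  ⟨fun p hp => hs.covering p (h hp), fun p hp q hq => hs.le_or_le p (h hp) q (h hq)⟩

omit [IsModularLattice M] in
open Classical in
theorem IsCoveringFamily.insert_of_forall {s : Finset (M × M)} (hs : IsCoveringFamily x y s)
    (hp : IsEquivCovering x y p) (h : ∀ q ∈ s, p.2 ≤ q.1 ∨ q.2 ≤ p.1) :
    IsCoveringFamily x y (insert p s) ∧ (insert p s).card = s.card + 1 := by
  refine ⟨⟨?_, ?_⟩, Finset.card_insert_of_notMem fun hps => ?_⟩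
  · exact Finset.forall_mem_insert _ _ _ |>.2 ⟨hp, hs.covering⟩
  · intro q hq r hr hqr
    rcases Finset.mem_insert.1 hq with hq' | hq'
    · rcases Finset.mem_insert.1 hr with hr' | hr'
      · exact absurd (hq'.trans hr'.symm) hqr
      · exact hq' ▸ h r hr'
    · rcases Finset.mem_insert.1 hr with hr' | hr'
      · exact hr' ▸ (h q hq').symm
      · exact hs.le_or_le q hq' r hr' hqr
  · rcases h p hps with h | h <;> exact absurd h hp.1.lt.not_ge

omit [IsModularLattice M] in
/-- The coverings of a chain are linearly ordered. -/
theorem isCoveringFamily_of_isChain {C : Set M} (hC : IsChain (· ≤ ·) C) {s : Finset (M × M)}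
    (hs : ∀ p ∈ s, p.1 ∈ C ∧ p.2 ∈ C ∧ p.1 ⋖ p.2 ∧ ProjEquiv p (x, y)) :
    IsCoveringFamily x y s := by
  refine ⟨fun p hp => (hs p hp).2.2, fun p hp q hq hpq => ?_⟩
  obtain ⟨p1, p2, pc, -⟩ := hs p hp
  obtain ⟨q1, q2, qc, -⟩ := hs q hq
  by_contra! hne
  have h1 := (hC.total p2 q1).resolve_left hne.1
  have h2 := (hC.total q2 p1).resolve_left hne.2
  have h1' : q.1 < p.2 := lt_of_le_not_ge h1 hne.1
  have h2' : p.1 < q.2 := lt_of_le_not_ge h2 hne.2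
  have e1 : p.1 = q.1 := by
    rcases hC.total p1 q1 with h | h
    · exact h.eq_of_not_lt fun h => pc.2 h h1'
    · exact (h.eq_of_not_lt fun h => qc.2 h h2').symm
  have e2 : p.2 = q.2 := by
    rcases hC.total p2 q2 with h | h
    · exact h.eq_of_not_lt fun h => qc.2 (e1 ▸ pc.lt) h
    · exact (h.eq_of_not_lt fun h => pc.2 (e1 ▸ qc.lt) h).symm
  exact hpq (Prod.ext e1 e2)

omit [IsModularLattice M] in
/-- The members of a finite family of coverings form a chain. -/
theorem IsCoveringFamily.exists_isChain {s : Finset (M × M)} (hs : IsCoveringFamily x y s) :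
    ∃ C : Set M, IsChain (· ≤ ·) C ∧ (s.card : Cardinal) ≤ chainMultiplicity C x y := by
  refine ⟨{a | ∃ p ∈ s, a = p.1 ∨ a = p.2}, ?_, ?_⟩
  · rintro a ⟨p, hp, ha⟩ b ⟨q, hq, hb⟩ -
    have hp' := (hs.covering p hp).1.le
    have hq' := (hs.covering q hq).1.le
    have lep : p.1 ≤ a ∧ a ≤ p.2 := by rcases ha with rfl | rfl <;> simp [hp']
    have leq : q.1 ≤ b ∧ b ≤ q.2 := by rcases hb with rfl | rfl <;> simp [hq']
    by_cases hpq : p = q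
    · subst hpq
      rcases ha with rfl | rfl
      · exact Or.inl leq.1
      · exact Or.inr leq.2
    · rcases hs.le_or_le p hp q hq hpq with h | h
      · exact Or.inl (lep.2.trans (h.trans leq.1))
      · exact Or.inr (leq.2.trans (h.trans lep.1))
  · rw [← Cardinal.mk_coe_finset]
    refine Cardinal.mk_subtype_mono fun p hp => ?_
    exact ⟨⟨p, hp, Or.inl rfl⟩, ⟨p, hp, Or.inr rfl⟩, hs.covering p hp⟩

omit [IsModularLattice M] in
theorem exists_isCoveringFamily {C : Set M} (hC : IsChain (· ≤ ·) C) {n : ℕ}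
    (h : (n : Cardinal) ≤ chainMultiplicity C x y) :
    ∃ s : Finset (M × M), IsCoveringFamily x y s ∧ s.card = n := by
  obtain ⟨s, hs⟩ := Cardinal.exists_finset_eq_card h
  refine ⟨s.map (Function.Embedding.subtype _), isCoveringFamily_of_isChain hC ?_, ?_⟩
  · intro p hp
    obtain ⟨q, -, rfl⟩ := Finset.mem_map.1 hp
    exact q.2
  · rw [Finset.card_map]
    exact hs.symm

omit [IsModularLattice M] in
/-- If the multiplicity is bounded, then some member of a family is separated by no covering from
the members above it. -/
theorem exists_isFree_of_bounded {n : ℕ}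
    (hn : ∀ s : Finset (M × M), IsCoveringFamily x y s → s.card ≤ n)
    {ι : Type*} [Nonempty ι] (F : ι → M) :
    ∃ i, ∀ j, F i ≤ F j → IsFree x y (F i) (F j) := by
  by_contra! H
  -- If every member had a covering above it, climbing would collect arbitrarily many.
  have key : ∀ k : ℕ, ∃ i, ∃ s : Finset (M × M), IsCoveringFamily x y s ∧ s.card = k ∧
      ∀ p ∈ s, p.2 ≤ F i := by
    intro k
    induction k with
    | zero => exact ⟨Classical.arbitrary ι, ∅, isCoveringFamily_empty, by simp, by simp⟩
    | succ k ih =>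
      classical
      obtain ⟨i, s, hs, hk, hi⟩ := ih
      obtain ⟨j, hij, hj⟩ := H i
      simp only [IsFree, not_forall, not_not] at hj
      obtain ⟨p, hp, h1, h2⟩ := hj
      obtain ⟨h, hc⟩ := hs.insert_of_forall hp fun q hq => Or.inr ((hi q hq).trans h1)
      refine ⟨j, insert p s, h, by rw [hc, hk], fun q hq => ?_⟩
      rcases Finset.mem_insert.1 hq with rfl | hq
      · exact h2
      · exact (hi q hq).trans hij
  obtain ⟨-, s, hs, hk, -⟩ := key (n + 1)
  have := hn s hs
  omega

omit [IsModularLattice M] in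
/-- If the multiplicity is bounded, then some member of a family is separated by no covering from
the members below it. -/
theorem exists_isFree_of_bounded' {n : ℕ}
    (hn : ∀ s : Finset (M × M), IsCoveringFamily x y s → s.card ≤ n)
    {ι : Type*} [Nonempty ι] (F : ι → M) :
    ∃ i, ∀ j, F j ≤ F i → IsFree x y (F j) (F i) := by
  by_contra! H
  have key : ∀ k : ℕ, ∃ i, ∃ s : Finset (M × M), IsCoveringFamily x y s ∧ s.card = k ∧
      ∀ p ∈ s, F i ≤ p.1 := by
    intro k
    induction k with
    | zero => exact ⟨Classical.arbitrary ι, ∅, isCoveringFamily_empty, by simp, by simp⟩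
    | succ k ih =>
      classical
      obtain ⟨i, s, hs, hk, hi⟩ := ih
      obtain ⟨j, hij, hj⟩ := H i
      simp only [IsFree, not_forall, not_not] at hj
      obtain ⟨p, hp, h1, h2⟩ := hj
      obtain ⟨h, hc⟩ := hs.insert_of_forall hp fun q hq => Or.inl (h2.trans (hi q hq))
      refine ⟨j, insert p s, h, by rw [hc, hk], fun q hq => ?_⟩
      rcases Finset.mem_insert.1 hq with rfl | hq
      · exact h1
      · exact hij.trans (hi q hq)
  obtain ⟨-, s, hs, hk, -⟩ := key (n + 1)
  have := hn s hs
  omega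

end Modular

/-! ### The modular lattice of filters and the principal embedding -/

namespace Fil

variable {L : Type u} [CompleteLattice L]

theorem mem_of_le {F : Fil L} {a b : L} (h : a ≤ b) (ha : a ∈ F.toPFilter) : b ∈ F.toPFilter :=
  Order.PFilter.mem_of_le h ha

theorem le_principal_iff {F : Fil L} {z : L} : F ≤ principal z ↔ z ∈ F.toPFilter :=
  ⟨fun h => le_iff.1 h (mem_principal.2 le_rfl),
    fun h => le_iff.2 fun _ hw => mem_of_le (mem_principal.1 hw) h⟩

theorem principal_le_iff {F : Fil L} {z : L} : principal z ≤ F ↔ ∀ w ∈ F.toPFilter, z ≤ w :=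
  ⟨fun h _ hw => mem_principal.1 (le_iff.1 h hw), fun h => le_iff.2 fun _ hw => h _ hw⟩

theorem principal_le_principal {a b : L} : principal a ≤ principal b ↔ a ≤ b :=
  le_principal_iff.trans mem_principal

theorem principal_injective : Function.Injective (principal : L → Fil L) := fun _ _ h =>
  le_antisymm (principal_le_principal.1 h.le) (principal_le_principal.1 h.ge)

theorem mem_sup {F G : Fil L} {z : L} :
    z ∈ (F ⊔ G).toPFilter ↔ z ∈ F.toPFilter ∧ z ∈ G.toPFilter := by
  simp only [← le_principal_iff, sup_le_iff]

/-- The union of a directed family of filters is its greatest lower bound. -/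
theorem mem_iInf_of_directed {ι : Sort*} [Nonempty ι] {F : ι → Fil L}
    (hF : Directed (· ≥ ·) F) {z : L} :
    z ∈ (⨅ i, F i).toPFilter ↔ ∃ i, z ∈ (F i).toPFilter := by
  refine ⟨fun hz => ?_, fun ⟨i, hi⟩ => le_principal_iff.1 ((iInf_le F i).trans
    (le_principal_iff.2 hi))⟩
  have hU : Order.IsPFilter {z : L | ∃ i, z ∈ (F i).toPFilter} := by
    refine Order.IsPFilter.of_def ⟨⊤, Classical.arbitrary ι, Order.PFilter.top_mem⟩ ?_ ?_
    · rintro a ⟨i, hi⟩ b ⟨j, hj⟩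
      obtain ⟨k, hik, hjk⟩ := hF i j
      exact ⟨a ⊓ b, ⟨k, Order.PFilter.inf_mem (le_iff.1 hik hi) (le_iff.1 hjk hj)⟩,
        inf_le_left, inf_le_right⟩
    · rintro a b hab ⟨i, hi⟩
      exact ⟨i, mem_of_le hab hi⟩
  have hle : ofPFilter hU.toPFilter ≤ ⨅ i, F i := le_iInf fun i => le_iff.2 fun w hw => ⟨i, hw⟩
  exact le_iff.1 hle hz

theorem mem_inf {F G : Fil L} {z : L} :
    z ∈ (F ⊓ G).toPFilter ↔ ∃ f ∈ F.toPFilter, ∃ g ∈ G.toPFilter, f ⊓ g ≤ z := by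
  constructor
  · intro hz
    have hU : Order.IsPFilter {z : L | ∃ f ∈ F.toPFilter, ∃ g ∈ G.toPFilter, f ⊓ g ≤ z} := by
      refine Order.IsPFilter.of_def
        ⟨⊤, ⊤, Order.PFilter.top_mem, ⊤, Order.PFilter.top_mem, le_top⟩ ?_ ?_
      · rintro a ⟨f, hf, g, hg, h⟩ b ⟨f', hf', g', hg', h'⟩
        refine ⟨a ⊓ b, ⟨f ⊓ f', Order.PFilter.inf_mem hf hf', g ⊓ g',
          Order.PFilter.inf_mem hg hg', ?_⟩, inf_le_left, inf_le_right⟩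
        rw [inf_inf_inf_comm]
        exact inf_le_inf h h'
      · rintro a b hab ⟨f, hf, g, hg, h⟩
        exact ⟨f, hf, g, hg, h.trans hab⟩
    have hle : ofPFilter hU.toPFilter ≤ F ⊓ G := le_inf
      (le_iff.2 fun w hw => ⟨w, hw, ⊤, Order.PFilter.top_mem, inf_le_left⟩)
      (le_iff.2 fun w hw => ⟨⊤, Order.PFilter.top_mem, w, hw, inf_le_right⟩)
    exact le_iff.1 hle hz
  · rintro ⟨f, hf, g, hg, h⟩
    rw [← le_principal_iff] at hf hg ⊢
    refine (inf_le_inf hf hg).trans (le_principal_iff.2 (mem_of_le h ?_))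
    exact Order.PFilter.inf_mem (le_principal_iff.1 inf_le_left) (le_principal_iff.1 inf_le_right)

theorem principal_inf (a b : L) : principal (a ⊓ b) = principal a ⊓ principal b := by
  refine le_antisymm (le_inf (principal_le_principal.2 inf_le_left)
    (principal_le_principal.2 inf_le_right)) (le_principal_iff.2 ?_)
  exact mem_inf.2 ⟨a, le_rfl, b, le_rfl, le_rfl⟩

theorem principal_sup (a b : L) : principal (a ⊔ b) = principal a ⊔ principal b := by
  refine le_antisymm (principal_le_iff.2 fun w hw => ?_) (sup_le
    (principal_le_principal.2 le_sup_left) (principal_le_principal.2 le_sup_right))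
  exact sup_le (mem_sup.1 hw).1 (mem_sup.1 hw).2

theorem transposesUp_principal {a b c d : L} (h : TransposesUp (a, b) (c, d)) :
    TransposesUp (principal a, principal b) (principal c, principal d) := by
  obtain ⟨h1, h2⟩ := h
  constructor
  · change principal b ⊓ principal c = principal a
    rw [← principal_inf]; exact congrArg _ h1
  · change principal b ⊔ principal c = principal d
    rw [← principal_sup]; exact congrArg _ h2

theorem projEquiv_principal {p q : L × L} (h : ProjEquiv p q) :
    ProjEquiv (principal p.1, principal p.2) (principal q.1, principal q.2) := by
  induction h with
  | rel p q h => exact .rel _ _ (transposesUp_principal h)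
  | refl p => exact .refl _
  | symm p q _ ih => exact .symm _ _ ih
  | trans p q r _ _ ih₁ ih₂ => exact .trans _ _ _ ih₁ ih₂

/-- For w in an intermediate filter, w ⊓ b lies between a and b; it is a only if the filter contains
a. -/
theorem covBy_principal {a b : L} (h : a ⋖ b) : principal a ⋖ principal b := by
  refine ⟨lt_of_le_not_ge (principal_le_principal.2 h.le)
    fun hn => h.lt.not_ge (principal_le_principal.1 hn), fun F h1 h2 => ?_⟩
  refine h1.not_ge (le_principal_iff.2 ?_)
  have hb : b ∈ F.toPFilter := le_principal_iff.1 h2.le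
  by_contra ha
  refine h2.not_ge (principal_le_iff.2 fun w hw => ?_)
  have haw := principal_le_iff.1 h1.le w hw
  rcases h.eq_or_eq (le_inf haw h.le) inf_le_right with h3 | h3
  · exact absurd (h3 ▸ Order.PFilter.inf_mem hw hb) ha
  · exact inf_eq_right.1 h3

theorem isEquivCovering_principal {x y : L} {p : L × L} (h : IsEquivCovering x y p) :
    IsEquivCovering (principal x) (principal y) (principal p.1, principal p.2) :=
  ⟨covBy_principal h.1, projEquiv_principal h.2⟩

instance [IsModularLattice L] : IsModularLattice (Fil L) where
  sup_inf_le_assoc_of_le {F} G {H} hFH := by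
    refine le_iff.2 fun w hw => ?_
    obtain ⟨hwF, hw2⟩ := mem_sup.1 hw
    obtain ⟨g, hg, h, hh, hgh⟩ := mem_inf.1 hw2
    -- By modularity of L, the witness meets h in (w ⊓ h) ⊔ (g ⊓ h), which is below w.
    refine mem_inf.2 ⟨w ⊓ h ⊔ g, mem_sup.2 ⟨mem_of_le le_sup_left
      (Order.PFilter.inf_mem hwF (le_iff.1 hFH hh)), mem_of_le le_sup_right hg⟩, h, hh, ?_⟩
    rw [sup_inf_assoc_of_le _ inf_le_right]
    exact sup_le inf_le_left hgh

/-! ### Descent of coverings from filters to L -/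

variable [IsModularLattice L]

/-- Every covering of filters equivalent to a principal one transposes up to principal ones. -/
def HasPrincipalTransposes (x y : L) (p : Fil L × Fil L) : Prop :=
  p.1 ⋖ p.2 ∧ ∀ z ∈ p.1.toPFilter, z ∉ p.2.toPFilter →
    ∃ w, IsEquivCovering x y (z, w) ∧ principal z ⊔ p.2 = principal w

theorem HasPrincipalTransposes.of_transposesUp {x y : L} {p q : Fil L × Fil L}
    (h : TransposesUp p q) (hp : HasPrincipalTransposes x y p) :
    HasPrincipalTransposes x y q := by
  refine ⟨h.covBy_iff.1 hp.1, fun z hz hz' => ?_⟩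
  obtain ⟨w, hw, e⟩ := hp.2 z (le_iff.1 (h.1 ▸ inf_le_right) hz)
    fun hzp => hz' (h.2 ▸ mem_sup.2 ⟨hzp, hz⟩)
  refine ⟨w, hw, ?_⟩
  rw [← e, ← h.2, sup_comm p.2, ← sup_assoc, sup_eq_left.2 (le_principal_iff.2 hz)]

omit [IsModularLattice L] in
theorem transposesUp_principal_of_mem {p : Fil L × Fil L} (hp : p.1 ⋖ p.2) {z : L}
    (hz : z ∈ p.1.toPFilter) (hz' : z ∉ p.2.toPFilter) :
    TransposesUp p (principal z, principal z ⊔ p.2) :=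
  ⟨inf_eq_of_covBy hp (le_principal_iff.2 hz) fun h => hz' (le_principal_iff.1 h),
    sup_comm _ _⟩

omit [IsModularLattice L] in
theorem exists_mem_notMem {p : Fil L × Fil L} (hp : p.1 ⋖ p.2) :
    ∃ z ∈ p.1.toPFilter, z ∉ p.2.toPFilter := by
  by_contra! h
  exact hp.lt.not_ge (le_iff.2 h)

/-- Both a and z cut q.2 down to q.1, so some g ≤ b in q.2 satisfies g ⊓ a = g ⊓ z. The covering g ⊓
z ≺ g of L then transposes up both to a ≺ b and to z ≺ g ⊔ z. -/
theorem HasPrincipalTransposes.of_transposesUp' {x y : L} {p q : Fil L × Fil L}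
    (h : TransposesUp q p) (hp : HasPrincipalTransposes x y p) :
    HasPrincipalTransposes x y q := by
  have hq : q.1 ⋖ q.2 := h.covBy_iff.2 hp.1
  refine ⟨hq, fun z hz hz' => ?_⟩
  obtain ⟨a, ha, ha'⟩ := exists_mem_notMem hp.1
  obtain ⟨b, hab, e⟩ := hp.2 a ha ha'
  have hqa : TransposesUp q (principal a, principal b) :=
    e ▸ h.trans (transposesUp_principal_of_mem hp.1 ha ha')
  have hqz := transposesUp_principal_of_mem hq hz hz'
  have ha1 : q.2 ⊓ principal a = q.1 := hqa.1
  have hz1 : q.2 ⊓ principal z = q.1 := hqz.1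
  have hb : b ∈ q.2.toPFilter := le_principal_iff.1 (le_sup_left.trans hqa.2.le)
  obtain ⟨g₁, hg₁, u, hu, h₁⟩ := mem_inf.1
    (ha1 ▸ le_principal_iff.1 (hqz.1 ▸ inf_le_right) : z ∈ (q.2 ⊓ principal a).toPFilter)
  obtain ⟨g₂, hg₂, v, hv, h₂⟩ := mem_inf.1
    (hz1 ▸ le_principal_iff.1 (hqa.1 ▸ inf_le_right) : a ∈ (q.2 ⊓ principal z).toPFilter)
  have h₁' : g₁ ⊓ a ≤ z := (inf_le_inf_left _ (mem_principal.1 hu)).trans h₁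
  have h₂' : g₂ ⊓ z ≤ a := (inf_le_inf_left _ (mem_principal.1 hv)).trans h₂
  set g := g₁ ⊓ g₂ ⊓ b
  have hg : g ∈ q.2.toPFilter :=
    Order.PFilter.inf_mem (Order.PFilter.inf_mem hg₁ hg₂) hb
  have hga : g ⊓ a = g ⊓ z := by
    refine le_antisymm (le_inf inf_le_left ?_) (le_inf inf_le_left ?_)
    · exact (inf_le_inf_right _ (inf_le_left.trans inf_le_left)).trans h₁'
    · exact (inf_le_inf_right _ (inf_le_left.trans inf_le_right)).trans h₂'
  have hgna : ¬ g ≤ a := fun hle => by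
    have : q.2 ≤ principal a := le_principal_iff.2 (mem_of_le hle hg)
    exact hq.lt.ne (ha1.symm.trans (inf_eq_left.2 this))
  have hgb : g ⊔ a = b := by
    rcases hab.1.eq_or_eq le_sup_right (sup_le inf_le_right hab.1.le) with h3 | h3
    · exact absurd (sup_eq_right.1 h3) hgna
    · exact h3
  have hup : TransposesUp (g ⊓ z, g) (a, b) := ⟨hga, hgb⟩
  have hgz : IsEquivCovering x y (z, g ⊔ z) :=
    (TransposesUp.isEquivCovering_iff (p := (g ⊓ z, g)) ⟨rfl, rfl⟩).1
      (hup.isEquivCovering_iff.2 hab)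
  refine ⟨g ⊔ z, hgz, ?_⟩
  have hcov : principal z ⋖ principal z ⊔ q.2 := hqz.covBy_iff.1 hq
  have hle : principal z ⊔ q.2 ≤ principal (g ⊔ z) :=
    sup_le (principal_le_principal.2 le_sup_right)
      (le_principal_iff.2 (mem_of_le le_sup_left hg))
  rcases (covBy_principal hgz.1).eq_or_eq le_sup_left hle with h3 | h3
  · exact absurd h3 hcov.lt.ne'
  · exact h3

theorem HasPrincipalTransposes.principal {x y : L} (h : x ⋖ y) :
    HasPrincipalTransposes x y (principal x, principal y) := by
  refine ⟨covBy_principal h, fun z hz hz' => ⟨z ⊔ y, ?_, (principal_sup z y).symm⟩⟩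
  refine (TransposesUp.isEquivCovering_iff (p := (x, y)) ⟨?_, sup_comm _ _⟩).1 ⟨h, .refl _⟩
  exact inf_eq_of_covBy h (mem_principal.1 hz) hz'

theorem hasPrincipalTransposes_iff_of_projEquiv {x y : L} {p q : Fil L × Fil L}
    (h : ProjEquiv p q) : HasPrincipalTransposes x y p ↔ HasPrincipalTransposes x y q := by
  induction h with
  | rel p q h => exact ⟨.of_transposesUp h, .of_transposesUp' h⟩
  | refl p => rfl
  | symm p q _ ih => exact ih.symm
  | trans p q r _ _ ih₁ ih₂ => exact ih₁.trans ih₂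

/-- A covering of filters equivalent to a principal covering transposes up to `⟨z, w⟩` for each
`z` that lies in its lower but not in its upper filter. -/
theorem exists_isEquivCovering {x y : L} (hxy : x ⋖ y) {p : Fil L × Fil L}
    (hp : IsEquivCovering (principal x) (principal y) p) {z : L} (hz : z ∈ p.1.toPFilter)
    (hz' : z ∉ p.2.toPFilter) :
    ∃ w, IsEquivCovering x y (z, w) ∧ Fil.principal z ⊔ p.2 = Fil.principal w :=
  ((hasPrincipalTransposes_iff_of_projEquiv hp.2).2 (.principal hxy)).2 z hz hz'

/-- Finite families of coverings of filters can be moved up to the lattice. -/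
theorem exists_isCoveringFamily_card_eq {x y : L} (hxy : x ⋖ y) (n : ℕ) (b : L)
    (s : Finset (Fil L × Fil L)) (hs : IsCoveringFamily (Fil.principal x) (Fil.principal y) s)
    (hn : s.card = n) (hb : ∀ p ∈ s, p.2 ≤ Fil.principal b) :
    ∃ t : Finset (L × L), IsCoveringFamily x y t ∧ t.card = n ∧ ∀ p ∈ t, p.2 ≤ b := by
  classical
  induction n generalizing b s with
  | zero => exact ⟨∅, isCoveringFamily_empty, by simp, by simp⟩
  | succ n ih =>
    obtain ⟨p, hp, hmax⟩ := Finset.exists_maximalFor (fun p : Fil L × Fil L => p.1) s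
      (Finset.card_pos.1 (by omega))
    have hpc := hs.covering p hp
    obtain ⟨z₀, hz₀, hz₀'⟩ := exists_mem_notMem hpc.1
    have hb2 : b ∈ p.2.toPFilter := le_principal_iff.1 (hb p hp)
    -- Meeting with b keeps the new covering below b. The rest of the family lies below p.1, so z₀ ⊓
    -- b is its bound in the induction.
    have hz : z₀ ⊓ b ∈ p.1.toPFilter := Order.PFilter.inf_mem hz₀ (le_iff.1 hpc.1.le hb2)
    have hz' : z₀ ⊓ b ∉ p.2.toPFilter := fun h => hz₀' (mem_of_le inf_le_left h)
    obtain ⟨w, hw, e⟩ := exists_isEquivCovering hxy hpc hz hz'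
    have hwb : w ≤ b := by
      rw [← principal_le_principal, ← e]
      exact sup_le (principal_le_principal.2 inf_le_right) (hb p hp)
    obtain ⟨t, ht, htn, htb⟩ := ih (z₀ ⊓ b) (s.erase p) (hs.subset (Finset.erase_subset _ _))
      (by rw [Finset.card_erase_of_mem hp, hn]; rfl) fun q hq => by
        obtain ⟨hqp, hq⟩ := Finset.mem_erase.1 hq
        rcases hs.le_or_le q hq p hp hqp with h | h
        · exact h.trans (le_principal_iff.2 hz)
        · have h1 := hpc.1.le.trans h
          exact absurd (h.trans (hmax hq h1)) hpc.1.lt.not_ge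
    obtain ⟨h1, h2⟩ := ht.insert_of_forall hw fun q hq => Or.inr (htb q hq)
    refine ⟨insert (z₀ ⊓ b, w) t, h1, by rw [h2, htn], ?_⟩
    exact (Finset.forall_mem_insert _ _ _).2
      ⟨hwb, fun q hq => ((htb q hq).trans hw.1.le).trans hwb⟩

end Fil

/-! ### Regularity and projection into maximal chains -/

namespace Fil

variable {L : Type u} [CompleteLattice L] [IsModularLattice L] {x y : L} {n : ℕ}

/-- A filter contains elements that no covering equivalent to `x ≺ y` separates from it. -/
theorem exists_mem_isFree
    (hn : ∀ s : Finset (Fil L × Fil L), IsCoveringFamily (principal x) (principal y) s →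
      s.card ≤ n) {F : Fil L} {f₀ : L} (hf₀ : f₀ ∈ F.toPFilter) :
    ∃ f ∈ F.toPFilter, f ≤ f₀ ∧ IsFree (principal x) (principal y) F (principal f) := by
  have : Nonempty {f : L // f ∈ F.toPFilter ∧ f ≤ f₀} := ⟨f₀, hf₀, le_rfl⟩
  obtain ⟨⟨f, hf, hff⟩, hfree⟩ := exists_isFree_of_bounded' hn
    fun f : {f : L // f ∈ F.toPFilter ∧ f ≤ f₀} => principal f.1
  refine ⟨f, hf, hff, fun p hp hFp hpf => ?_⟩
  obtain ⟨z, hz, hz'⟩ := exists_mem_notMem hp.1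
  have hzf : z ⊓ f ∈ p.1.toPFilter :=
    Order.PFilter.inf_mem hz (le_principal_iff.1 (hp.1.le.trans hpf))
  have hle : p.1 ≤ principal (z ⊓ f) := le_principal_iff.2 hzf
  by_cases h : p.2 ≤ p.1 ⊔ principal (z ⊓ f)
  · rw [sup_eq_right.2 hle] at h
    exact hz' (mem_of_le inf_le_left (le_principal_iff.1 h))
  · exact hfree ⟨z ⊓ f, le_iff.1 hFp hzf, inf_le_right.trans hff⟩
      (principal_le_principal.2 inf_le_right) _ (hp.sup h) le_sup_right
      (sup_le hpf (principal_le_principal.2 inf_le_right))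

/-- Coverings of filters equivalent to a covering of `L` of bounded multiplicity are not collapsed
by directed joins. -/
theorem not_le_iSup (hL : IsMeetContinuous L) (hxy : x ⋖ y)
    (hn : ∀ s : Finset (Fil L × Fil L), IsCoveringFamily (principal x) (principal y) s →
      s.card ≤ n) {ι : Type*} [Nonempty ι] {F : ι → Fil L} (hF : Directed (· ≤ ·) F)
    {p : Fil L × Fil L} (hp : IsEquivCovering (principal x) (principal y) p)
    (hpF : ∀ i, p.1 ≤ F i) (hpF' : ∀ i, ¬ p.2 ≤ F i) : ¬ p.2 ≤ ⨆ i, F i := by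
  obtain ⟨i, hi⟩ := exists_isFree_of_bounded hn F
  have hup : TransposesUp p (F i, p.2 ⊔ F i) :=
    ⟨inf_eq_of_covBy hp.1 (hpF i) (hpF' i), rfl⟩
  have hq := hup.isEquivCovering_iff.1 hp
  obtain ⟨f₀, hf₀, hf₀'⟩ := exists_mem_notMem hq.1
  obtain ⟨f, hf, hff₀, hfree⟩ := exists_mem_isFree hn hf₀
  have hf' : f ∉ (p.2 ⊔ F i).toPFilter := fun h => hf₀' (mem_of_le hff₀ h)
  obtain ⟨w, hw, e⟩ := exists_isEquivCovering hxy hq hf hf'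
  have hwK := isEquivCovering_principal hw
  -- No u in U lies above w, so w ⊓ u = f; yet every F j above F i contains sSup U.
  let U : Set L := {u | f ≤ u ∧ IsFree (principal x) (principal y) (F i) (principal u)}
  have hFf : F i ≤ principal f := le_principal_iff.2 hf
  have hFU : ∀ u ∈ U, F i ≤ principal u := fun u hu =>
    hFf.trans (principal_le_principal.2 hu.1)
  have hUsup : ∀ u ∈ U, ∀ v ∈ U, u ⊔ v ∈ U := fun u hu v hv =>
    ⟨hu.1.trans le_sup_left, principal_sup u v ▸ hu.2.sup (hFU u hu) (hFU v hv) hv.2⟩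
  have hUd : DirectedOn (· ≤ ·) U := fun u hu v hv =>
    ⟨u ⊔ v, hUsup u hu v hv, le_sup_left, le_sup_right⟩
  have hfU : f ∈ U := ⟨le_rfl, hfree⟩
  have hwU : w ⊓ sSup U ≤ f := by
    rw [hL w U hUd]
    refine iSup₂_le fun u hu => (inf_eq_of_covBy hw.1 hu.1 fun h => ?_).le
    exact hu.2 _ hwK hFf (principal_le_principal.2 h)
  have hmem : ∀ j, F i ≤ F j → sSup U ∈ (F j).toPFilter := by
    intro j hij
    obtain ⟨g, hg, -, hgfree⟩ := exists_mem_isFree hn (F := F j) Order.PFilter.top_mem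
    have hFg : F j ≤ principal g := le_principal_iff.2 hg
    refine mem_of_le (le_sup_right.trans (le_sSup (a := f ⊔ g) ⟨le_sup_left, ?_⟩)) hg
    rw [principal_sup]
    exact hfree.sup hFf (hij.trans hFg) ((hi j hij).trans hij hFg hgfree)
  have hsup : (⨆ j, F j) ≤ principal (sSup U) := by
    refine iSup_le fun j => ?_
    obtain ⟨k, hjk, hik⟩ := hF j i
    exact hjk.trans (le_principal_iff.2 (hmem k hik))
  intro hle
  have hwle : principal w ≤ principal (sSup U) := by
    rw [← e]
    exact sup_le (principal_le_principal.2 (le_sSup hfU))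
      (sup_le (hle.trans hsup) ((le_iSup F i).trans hsup))
  refine hw.1.lt.not_ge ?_
  rwa [inf_eq_left.2 (principal_le_principal.1 hwle)] at hwU

theorem _root_.LatticeCovering.IsCoveringChain.monotone {M : Type u} [Lattice M] {a b : M}
    {I : Type u} [LinearOrder I] {p : I → M × M} (h : IsCoveringChain a b p) :
    Monotone (fun i => (p i).1) ∧ Monotone (fun i => (p i).2) := by
  constructor <;> intro i j hij <;> rcases hij.eq_or_lt with rfl | hij
  · exact le_rfl
  · exact (h.transposesUp i j hij).1.ge.trans inf_le_right
  · exact le_rfl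
  · exact le_sup_left.trans (h.transposesUp i j hij).2.le

/-- Each p i transposes up to the pair of joins once `not_le_iSup` rules out collapse; it is applied
to the tail j ≥ i, where all lower ends are above that of p i. -/
theorem isUpperRegular (hL : IsMeetContinuous L) (hxy : x ⋖ y)
    (hn : ∀ s : Finset (Fil L × Fil L), IsCoveringFamily (principal x) (principal y) s →
      s.card ≤ n) : IsUpperRegular (principal x) (principal y) := by
  intro I _ _ p hp
  obtain ⟨hm1, hm2⟩ := hp.monotone
  let i : I := Classical.arbitrary I
  have hpi : IsEquivCovering (principal x) (principal y) (p i) := ⟨hp.covBy i, hp.equiv i⟩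
  have hsup1 : (⨆ j, (p j).1) = ⨆ j : Set.Ici i, (p j).1 := by
    refine le_antisymm (iSup_le fun j => ?_) (iSup_le fun j : Set.Ici i => le_iSup (fun j => (p j).1) j.1)
    exact (hm1 (le_max_left j i)).trans
      (le_iSup (fun j : Set.Ici i => (p j).1) ⟨max j i, le_max_right j i⟩)
  have hnot : ¬ (p i).2 ≤ ⨆ j, (p j).1 := by
    rw [hsup1]
    refine not_le_iSup (F := fun j : Set.Ici i => (p j).1) hL hxy hn
      (Monotone.directed_le fun a b hab => hm1 hab) hpi
      (fun j => hm1 j.2) fun j hle => ?_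
    rcases (show i ≤ j.1 from j.2).eq_or_lt with h | h
    · rw [← h] at hle
      exact (hp.covBy i).lt.not_ge hle
    · refine (hp.covBy i).lt.not_ge ?_
      rw [← (hp.transposesUp i j h).1, inf_eq_left.2 hle]
  refine (TransposesUp.covBy_iff (p := p i) (q := (⨆ j, (p j).1, ⨆ j, (p j).2)) ⟨?_, ?_⟩).1
    (hp.covBy i)
  · exact inf_eq_of_covBy (hp.covBy i) (le_iSup (fun j => (p j).1) i) hnot
  · refine le_antisymm (sup_le (le_iSup (fun j => (p j).2) i)
      (iSup_mono fun j => (hp.covBy j).le)) (iSup_le fun j => ?_)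
    rcases le_or_gt j i with h | h
    · exact (hm2 h).trans le_sup_left
    · exact (hp.transposesUp i j h).2.ge.trans
        (sup_le_sup_left (le_iSup (fun j => (p j).1) j) _)

theorem isLowerRegular (F G : Fil L) : IsLowerRegular F G := by
  intro I _ _ p hp
  obtain ⟨hm1, hm2⟩ := hp.monotone
  let i : I := Classical.arbitrary I
  refine (TransposesUp.covBy_iff (p := (⨅ j, (p j).1, ⨅ j, (p j).2)) (q := p i) ⟨?_, ?_⟩).2
    (hp.covBy i)
  · refine le_antisymm (le_iInf fun j => ?_)
      (le_inf (iInf_mono fun j => (hp.covBy j).le) (iInf_le (fun j => (p j).1) i))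
    rcases lt_or_ge j i with h | h
    · exact (inf_le_inf_right _ (iInf_le (fun j => (p j).2) j)).trans (hp.transposesUp j i h).1.le
    · exact inf_le_right.trans (hm1 h)
  · refine le_antisymm (sup_le (iInf_le (fun j => (p j).2) i) (hp.covBy i).le)
      (le_iff.2 fun z hz => ?_)
    obtain ⟨hz1, hz2⟩ := mem_sup.1 hz
    obtain ⟨j, hj⟩ := (mem_iInf_of_directed
      (Antitone.directed_ge (α := Iᵒᵈ) (f := fun j : Iᵒᵈ => (p (OrderDual.ofDual j)).2)
        fun a b hab => hm2 hab)).1 hz1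
    rcases lt_or_ge (OrderDual.ofDual j) i with h | h
    · exact (hp.transposesUp _ i h).2 ▸ mem_sup.2 ⟨hj, hz2⟩
    · exact le_iff.1 (hm2 h) hj

/-- Projecting a covering `p` into a maximal chain: the chain has a unique jump where meets with
`p.2` stop being below `p.1`. -/
theorem exists_covBy_of_isMaxChain (hL : IsMeetContinuous L) (hxy : x ⋖ y)
    (hn : ∀ s : Finset (Fil L × Fil L), IsCoveringFamily (principal x) (principal y) s →
      s.card ≤ n) {C : Set (Fil L)} (hC : IsMaxChain (· ≤ ·) C) {p : Fil L × Fil L}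
    (hp : IsEquivCovering (principal x) (principal y) p) :
    ∃ q : Fil L × Fil L, (q.1 ∈ C ∧ q.2 ∈ C ∧ q.1 ⋖ q.2 ∧ ProjEquiv q (principal x, principal y)) ∧
      q.1 ⊓ p.2 ≤ p.1 ∧ ¬ q.2 ⊓ p.2 ≤ p.1 := by
  let A := {c : Fil L // c ∈ C ∧ c ⊓ p.2 ≤ p.1}
  let B := {c : Fil L // c ∈ C ∧ ¬ c ⊓ p.2 ≤ p.1}
  have hAB : ∀ (a : A) (b : B), a.1 ≤ b.1 := fun a b =>
    (hC.1.total a.2.1 b.2.1).resolve_right fun h =>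
      b.2.2 ((inf_le_inf_right _ h).trans a.2.2)
  have hA : Nonempty A := ⟨⊥, hC.bot_mem, by simp⟩
  have hB : Nonempty B := ⟨⊤, hC.top_mem, by simpa using hp.1.lt.not_ge⟩
  have hmem : ∀ c, (∀ a : A, a.1 ≤ c ∨ c ≤ a.1) → (∀ b : B, b.1 ≤ c ∨ c ≤ b.1) → c ∈ C := by
    intro c h1 h2
    have := hC.2 (hC.1.insert (a := c) fun d hd _ => ?_) (Set.subset_insert c C)
    · exact this ▸ Set.mem_insert c C
    · by_cases h : d ⊓ p.2 ≤ p.1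
      · exact (h1 ⟨d, hd, h⟩).symm
      · exact (h2 ⟨d, hd, h⟩).symm
  set a : Fil L := ⨆ c : A, c.1
  set b : Fil L := ⨅ c : B, c.1
  have hab : a ≤ b := iSup_le fun c => le_iInf fun d => hAB c d
  have haA : ∀ c : A, c.1 ≤ a := fun c => le_iSup (fun c : A => c.1) c
  have hbB : ∀ c : B, b ≤ c.1 := fun c => iInf_le (fun c : B => c.1) c
  have haC : a ∈ C := hmem a (fun c => Or.inl (haA c)) fun c => Or.inr (hab.trans (hbB c))
  have hbC : b ∈ C := hmem b (fun c => Or.inl ((haA c).trans hab)) fun c => Or.inr (hbB c)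
  have hAd : Directed (· ≤ ·) fun c : A => p.1 ⊔ c.1 := fun c d => by
    rcases hC.1.total c.2.1 d.2.1 with h | h
    · exact ⟨d, sup_le_sup_left h _, le_rfl⟩
    · exact ⟨c, le_rfl, sup_le_sup_left h _⟩
  -- The supremum a stays on the lower side of the cut: joins with p.1 make `not_le_iSup`
  -- applicable.
  have hap : ¬ p.2 ≤ p.1 ⊔ a := by
    have := not_le_iSup hL hxy hn hAd hp (fun c => le_sup_left) fun c hle => by
      refine hp.1.lt.not_ge ?_
      have h := sup_inf_assoc_of_le c.1 hp.1.le
      rw [inf_eq_right.2 hle, sup_eq_left.2 c.2.2] at h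
      exact h.le
    rwa [← sup_iSup] at this
  have ha' : a ⊓ p.2 ≤ p.1 := by
    rw [← inf_eq_of_covBy hp.1 le_sup_left hap, inf_comm]
    exact inf_le_inf_left _ le_sup_right
  have hBd : Directed (· ≥ ·) fun c : B => c.1 := fun c d => by
    rcases hC.1.total c.2.1 d.2.1 with h | h
    · exact ⟨c, le_rfl, h⟩
    · exact ⟨d, h, le_rfl⟩
  -- The infimum b stays on the upper side: b is the union of the filters c, so one c already
  -- supplies f.
  have hb' : ¬ b ⊓ p.2 ≤ p.1 := by
    intro hle
    obtain ⟨z, hz, hz'⟩ := exists_mem_notMem hp.1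
    obtain ⟨f, hf, g, hg, hfg⟩ := mem_inf.1 (le_iff.1 hle hz)
    obtain ⟨c, hc⟩ := (mem_iInf_of_directed hBd).1 hf
    have hsup : p.1 ⊔ c.1 ⊓ p.2 = p.2 :=
      (hp.1.eq_or_eq le_sup_left (sup_le hp.1.le inf_le_right)).resolve_left fun h =>
        c.2.2 (sup_eq_left.1 h)
    exact hz' (hsup ▸ mem_sup.2 ⟨hz, mem_inf.2 ⟨f, hc, g, hg, hfg⟩⟩)
  have hbp : ¬ b ⊓ p.2 ≤ a := fun h => hb' ((le_inf h inf_le_right).trans ha')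
  have hcov : a ⋖ b := by
    refine ⟨lt_of_le_of_ne hab fun h => hbp (h ▸ inf_le_left), fun c h1 h2 => ?_⟩
    have hc : c ∈ C := hmem c (fun d => Or.inl ((haA d).trans h1.le))
      fun d => Or.inr (h2.le.trans (hbB d))
    by_cases h : c ⊓ p.2 ≤ p.1
    · exact h1.not_ge (haA ⟨c, hc, h⟩)
    · exact h2.not_ge (hbB ⟨c, hc, h⟩)
  refine ⟨(a, b), ⟨haC, hbC, ?_⟩, ha', hb'⟩
  -- The covering p.1 ⊓ b ≺ p.2 ⊓ b links the two: it transposes up to p and, since p.1 ⊓ b = p.2 ⊓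
  -- a, also to a ≺ b.
  have hple : p.2 ≤ p.1 ⊔ b := by
    rcases hp.1.eq_or_eq le_sup_left (sup_le hp.1.le inf_le_right : p.1 ⊔ b ⊓ p.2 ≤ p.2)
      with h | h
    · exact absurd (sup_eq_left.1 h) hb'
    · exact h.ge.trans (sup_le_sup_left inf_le_left _)
  have hinf := hp.inf hple
  have hsup : p.2 ⊓ b ⊔ a = b :=
    (hcov.eq_or_eq le_sup_right (sup_le inf_le_right hab)).resolve_left fun h =>
      hbp (inf_comm b p.2 ▸ sup_eq_right.1 h)
  have hcov' : p.2 ⊓ a ⋖ p.2 ⊓ b :=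
    (TransposesUp.covBy_iff (p := (p.2 ⊓ a, p.2 ⊓ b)) (q := (a, b))
      ⟨show p.2 ⊓ b ⊓ a = p.2 ⊓ a by rw [inf_assoc, inf_eq_right.2 hab], hsup⟩).2 hcov
  have hpba : p.1 ⊓ b = p.2 ⊓ a :=
    (hcov'.eq_or_eq (le_inf (inf_comm a p.2 ▸ ha') (inf_le_right.trans hab))
      hinf.1.le).resolve_right hinf.1.lt.ne
  refine (TransposesUp.isEquivCovering_iff (p := (p.1 ⊓ b, p.2 ⊓ b)) ⟨?_, hsup⟩).1 hinf
  change p.2 ⊓ b ⊓ a = p.1 ⊓ b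
  rw [hpba, inf_assoc, inf_eq_right.2 hab]

end Fil

/-! ### Counting coverings -/

/-- If the multiplicity upper bound is finite, it exceeds by one the largest size of a finite family
of equivalent coverings occurring in a common chain. -/
theorem exists_isCoveringFamily_max {M : Type u} [Lattice M] {x y : M}
    (hfin : multiplicityUpperBound x y < Cardinal.aleph0) :
    ∃ n : ℕ, multiplicityUpperBound x y = Order.succ (n : Cardinal.{u}) ∧
      (∃ s : Finset (M × M), IsCoveringFamily x y s ∧ s.card = n) ∧
      ∀ s : Finset (M × M), IsCoveringFamily x y s → s.card ≤ n := by
  obtain ⟨N, hN⟩ := Cardinal.lt_aleph0.1 hfin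
  have hlt := multiplicityUpperBound_spec x y
  rw [hN] at hlt
  -- The bound is strict, so the empty chain already excludes N = 0.
  obtain ⟨n, rfl⟩ : ∃ n, N = n + 1 := by
    refine Nat.exists_eq_succ_of_ne_zero ?_
    rintro rfl
    exact absurd (hlt ∅ (by simp [IsChain])) (by simp)
  refine ⟨n, by rw [hN, Nat.cast_succ, ← Cardinal.succ_natCast], ?_, fun s hs => ?_⟩
  · by_contra! H
    have hle : multiplicityUpperBound x y ≤ (n : Cardinal.{u}) := by
      refine csInf_le' fun C hC => lt_of_not_ge fun hn => ?_
      obtain ⟨s, hs, hsn⟩ := exists_isCoveringFamily hC hn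
      exact H s hs hsn
    rw [hN] at hle
    have := Nat.cast_le.1 hle
    omega
  · obtain ⟨C, hC, hs⟩ := hs.exists_isChain
    exact Nat.lt_succ_iff.1 (Nat.cast_lt.1 (hs.trans_lt (hlt C hC)))

namespace Fil

variable {L : Type u} [CompleteLattice L] [IsModularLattice L] {x y : L} {n : ℕ}

/-- A maximal chain of filters realizes at least as many coverings as any finite family. -/
theorem card_le_chainMultiplicity (hL : IsMeetContinuous L) (hxy : x ⋖ y)
    (hn : ∀ s : Finset (Fil L × Fil L), IsCoveringFamily (principal x) (principal y) s →
      s.card ≤ n) {C : Set (Fil L)} (hC : IsMaxChain (· ≤ ·) C) {s : Finset (Fil L × Fil L)}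
    (hs : IsCoveringFamily (principal x) (principal y) s) :
    (s.card : Cardinal.{u}) ≤ chainMultiplicity C (principal x) (principal y) := by
  have H (p : s) := exists_covBy_of_isMaxChain hL hxy hn hC (hs.covering p.1 p.2)
  choose φ hφ h1 h2 using H
  have key : ∀ p q : s, φ p = φ q → ¬ p.1.2 ≤ q.1.1 := by
    intro p q hpq hle
    have hc : (φ p).1 ⋖ (φ p).2 := (hφ p).2.2.1
    have h3 : ¬ (φ p).2 ⊓ q.1.2 ≤ q.1.1 := hpq ▸ h2 q
    have h4 : (φ p).1 ⊓ q.1.2 ≤ q.1.1 := hpq ▸ h1 q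
    -- Otherwise (φ p).2 is the join of (φ p).2 ⊓ q.1.1 and (φ p).1, and by modularity its meet with
    -- q.1.2 falls below q.1.1, against `h3`.
    have h5 : (φ p).2 ⊓ q.1.1 ≤ (φ p).1 := by
      rcases hc.eq_or_eq le_sup_right (sup_le inf_le_left hc.le :
        (φ p).2 ⊓ q.1.1 ⊔ (φ p).1 ≤ (φ p).2) with h | h
      · exact sup_eq_right.1 h
      · refine absurd ?_ h3
        rw [← h, sup_inf_assoc_of_le _ (inf_le_right.trans (hs.covering q.1 q.2).1.le)]
        exact sup_le inf_le_right h4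
    exact h2 p ((le_inf ((inf_le_inf_left _ hle).trans h5) inf_le_right).trans (h1 p))
  rw [← Cardinal.mk_coe_finset]
  refine Cardinal.mk_le_of_injective (f := fun p : s => ⟨φ p, hφ p⟩) fun p q hpq => ?_
  have hpq : φ p = φ q := congrArg Subtype.val hpq
  by_contra hne
  rcases hs.le_or_le p.1 p.2 q.1 q.2 fun h => hne (Subtype.ext h) with h | h
  · exact key p q hpq h
  · exact key q p hpq.symm h

end Fil

end LatticeCovering

theorem mainTheorem1 {L : Type u} [CompleteLattice L] [IsModularLattice L]
    (hL : IsMeetContinuous L) (x y : L) (hxy : x ⋖ y)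
    (hfin : multiplicityUpperBound x y < Cardinal.aleph0) :
    IsRegularCovering (Fil.principal x) (Fil.principal y) ∧
      ∃ n : Cardinal.{u}, HasMultiplicity (Fil.principal x) (Fil.principal y) n ∧
        Order.succ n = multiplicityUpperBound x y := by
  obtain ⟨n, hn, ⟨s, hs, hsn⟩, hmax⟩ := exists_isCoveringFamily_max hfin
  have hmax' : ∀ s : Finset (Fil L × Fil L),
      IsCoveringFamily (Fil.principal x) (Fil.principal y) s → s.card ≤ n := by
    intro t ht
    obtain ⟨t', ht', hcard, -⟩ := Fil.exists_isCoveringFamily_card_eq hxy _ ⊤ t ht rfl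
      fun p _ => Fil.le_principal_iff.2 Order.PFilter.top_mem
    exact hcard ▸ hmax t' ht'
  refine ⟨⟨Fil.covBy_principal hxy, Fil.isUpperRegular hL hxy hmax', Fil.isLowerRegular _ _⟩,
    n, fun C hC => le_antisymm ?_ ?_, hn.symm⟩
  · by_contra h
    have h1 : ((n + 1 : ℕ) : Cardinal.{u}) ≤
        chainMultiplicity C (Fil.principal x) (Fil.principal y) := by
      rw [Nat.cast_succ, ← Cardinal.succ_natCast]
      exact Order.succ_le_of_lt (not_le.1 h)
    obtain ⟨t, ht, htn⟩ := exists_isCoveringFamily hC.1 h1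
    have := hmax' t ht
    omega
  -- A largest family in L, sent to principal filters, is projected into C.
  · let e : L × L ↪ Fil L × Fil L := ⟨Prod.map Fil.principal Fil.principal,
      Fil.principal_injective.prodMap Fil.principal_injective⟩
    have hse : IsCoveringFamily (Fil.principal x) (Fil.principal y) (s.map e) := by
      refine ⟨?_, ?_⟩
      · intro p hp
        obtain ⟨q, hq, rfl⟩ := Finset.mem_map.1 hp
        exact Fil.isEquivCovering_principal (hs.covering q hq)
      · intro p hp q hq hpq
        obtain ⟨p, hps, rfl⟩ := Finset.mem_map.1 hp
        obtain ⟨q, hqs, rfl⟩ := Finset.mem_map.1 hq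
        exact (hs.le_or_le p hps q hqs fun h => hpq (h ▸ rfl)).imp
          Fil.principal_le_principal.2 Fil.principal_le_principal.2
    have := Fil.card_le_chainMultiplicity hL hxy hmax' hC hse
    rwa [Finset.card_map, hsn] at this
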